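/- For a (finite or infinite) simple graph $G$ with vertex set $V$, let $\Theta(G)$ be the simplicial complex whose simplices are the nonempty finite sets $\sigma\subseteq V$ for which there is an edge $\{a,b\}$ of $G$ with $\sigma\cap\{a,b\}=\emptyset$. We identify a simplicial complex with its geometric realization (with the weak topology), and we let $\Sigma X$ be the unreduced suspension of a space $X$, obtained from $X\times[0,1]\sqcup\{p_0,p_1\}$ by identifying $X\times\{0\}$ with $p_0$ and $X\times\{1\}$ with $p_1$ (so $\Sigma\emptyset=S^0$). Proposition. Let $G$ be a simple graph, let $vw$ be an edge of $G$, and let $\widetilde G$ be the graph obtained from $G$ by inserting three new interior vertices on this edge, that is, $\widetilde G$ has vertex set $V\sqcup\{x_1,x_2,x_3\}$ and its edges are the edges of $G$ other than $vw$ together with $vx_1,\ x_1x_2,\ x_2x_3,\ x_3w$. Then there is a homotopy equivalence $$\Theta(\widetilde G)\simeq\Sigma^2\,\Theta(G).$$ -/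

import Mathlib

noncomputable section

/-- The theta complex of a hypergraph: its simplices are the nonempty finite sets of vertices that
lie in the complement of at least one hyperedge. A vertex contained in every hyperedge is not a
vertex of the complex. -/
def Hypergraph.theta {α : Type*} (H : Hypergraph α) : PreAbstractSimplicialComplex α where
  faces := {s | s.Nonempty ∧ ∃ e ∈ H.edgeSet, (s : Set α) ⊆ H.vertexSet \ e}
  isRelLowerSet_faces := by
    rintro s ⟨hs, e, he, hse⟩
    exact ⟨hs, fun t hts ht => ⟨ht, e, he, fun x hx => hse (hts hx)⟩⟩

namespace SimpleGraph

variable {V : Type*}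

/-- A graph seen as a hypergraph: every vertex of the type is a vertex, and the hyperedges are the
pairs of adjacent vertices. -/
def toHypergraph (G : SimpleGraph V) : Hypergraph V where
  vertexSet := Set.univ
  edgeSet := {e | ∃ a b : V, G.Adj a b ∧ e = {a, b}}
  subset_vertexSet_of_mem_edgeSet' := fun _ _ => Set.subset_univ _

/-- The theta complex of a graph. -/
abbrev theta (G : SimpleGraph V) : PreAbstractSimplicialComplex V := G.toHypergraph.theta

/-- The graph obtained from `G` by inserting three new interior vertices `x₁, x₂, x₃` (the elements
`0, 1, 2` of `Fin 3`) on the edge `vw`: the edge `vw` is replaced by the path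
`v, x₁, x₂, x₃, w`. It is meant for adjacent `v` and `w`. -/
def insertThree (G : SimpleGraph V) (v w : V) : SimpleGraph (V ⊕ Fin 3) :=
  SimpleGraph.fromEdgeSet
    (Sym2.map Sum.inl '' (G.edgeSet \ {s(v, w)}) ∪
      {s(Sum.inl v, Sum.inr 0), s(Sum.inr 0, Sum.inr 1), s(Sum.inr 1, Sum.inr 2),
        s(Sum.inr 2, Sum.inl w)})

end SimpleGraph

namespace PreAbstractSimplicialComplex

variable {V : Type*}

/-- The closed geometric simplex spanned by a finite set `s` of vertices, in barycentric
coordinates. As a subspace of the product `V → ℝ` it is the Euclidean simplex on `s`. -/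
def closedCell (s : Finset V) : Set (V → ℝ) :=
  {f | (∀ v, 0 ≤ f v) ∧ (∀ v, v ∉ s → f v = 0) ∧ ∑ v ∈ s, f v = 1}

/-- The geometric realization of an abstract simplicial complex: the union of the closed simplices
of its faces. Its topology is the weak one, see the instance below, and not the one induced from
`V → ℝ` (the two agree when `V` is finite). -/
def Realization (K : PreAbstractSimplicialComplex V) : Type _ :=
  {f : V → ℝ // ∃ s ∈ K, f ∈ closedCell s}

/-- The inclusion of the closed simplex of a face. -/
def cellIncl (K : PreAbstractSimplicialComplex V) (s : {s : Finset V // s ∈ K}) :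
    closedCell s.1 → K.Realization :=
  fun f => ⟨f.1, s.1, s.2, f.2⟩

/-- The weak topology: the finest one for which all inclusions of closed simplices are continuous,
that is, a set is open if and only if it meets each closed simplex in an open subset of that
simplex. -/
instance (K : PreAbstractSimplicialComplex V) : TopologicalSpace K.Realization :=
  ⨆ s : {s : Finset V // s ∈ K}, TopologicalSpace.coinduced (K.cellIncl s) inferInstance

end PreAbstractSimplicialComplex

/-- The identifications in the (unreduced) suspension: the two ends of the cylinder `X × [0, 1]` are
attached to the two poles `false` and `true`. -/
inductive SuspensionRel (X : Type*) : (X × unitInterval) ⊕ Bool → (X × unitInterval) ⊕ Bool → Prop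
  | south (x : X) : SuspensionRel X (Sum.inl (x, 0)) (Sum.inr false)
  | north (x : X) : SuspensionRel X (Sum.inl (x, 1)) (Sum.inr true)

/-- The unreduced suspension of a space. The poles are always present, so that the suspension of
the empty space is the two-point discrete space, the sphere of dimension `0`. -/
def Suspension (X : Type*) : Type _ := Quot (SuspensionRel X)

instance (X : Type*) [TopologicalSpace X] : TopologicalSpace (Suspension X) :=
  inferInstanceAs (TopologicalSpace (Quot (SuspensionRel X)))

end

/-! Let B be the complex of nonempty finite sets without x₂ that do not contain both x₁ and x₃. Each
of them misses x₁x₂ or x₂x₃, so B lies in Θ(G̃). Moreover B is a cone with apex v, so attaching a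
cone over B with a new apex y keeps the homotopy type. A face containing both x₁ and x₃ meets all
four new edges, hence misses an old edge (an edge of G other than vw); it can be joined to x₂ and
pushed away. What remains is the cone with apex x₂ over a link L together with the cone with apex y
over B. The latter shrinks to the cone over L, which leaves ΣL. The faces of L contain at most one
of x₁, x₃ and miss an old edge, vx₁ or x₃w. Pushing towards x₁ and then x₃, carried out on ΣL,
leaves the double simplicial suspension of Θ(G), with inner poles x₁, x₃ and outer poles x₂, y.

All five moves are instances of `homotopyEquiv_of_push`. Its hypotheses say that the faces of P
outside Q pair off as s, s ∪ {p}. The retraction subtracts from all coordinates except that of p the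
least amount that leaves a face of Q or nothing, cuts off at zero, and gives the lost mass to p. One
formula treats all faces at once, so V may be infinite. Finally `suspHomeomorph` identifies
simplicial and topological suspensions. -/

open Topology

namespace PreAbstractSimplicialComplex

/-! ### Closed cells, the weak topology and straight-line homotopies -/

section Cells

variable {U V : Type*} {K : PreAbstractSimplicialComplex V} {L : PreAbstractSimplicialComplex U}

theorem nonempty_of_mem {s : Finset V} (hs : s ∈ K) : s.Nonempty :=
  (K.isRelLowerSet_faces hs).1

theorem mem_of_subset {s t : Finset V} (hs : s ∈ K) (hts : t ⊆ s) (ht : t.Nonempty) : t ∈ K :=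
  (K.isRelLowerSet_faces hs).2 hts ht

theorem closedCell_of_support {s t : Finset V} {f : V → ℝ} (hf : f ∈ closedCell s)
    (h : ∀ v, v ∉ t → f v = 0) : f ∈ closedCell t := by
  classical
  refine ⟨hf.1, h, ?_⟩
  rw [← hf.2.2]
  have h1 : ∑ v ∈ t, f v = ∑ v ∈ s ∪ t, f v :=
    Finset.sum_subset Finset.subset_union_right fun v _ hv => h v hv
  have h2 : ∑ v ∈ s, f v = ∑ v ∈ s ∪ t, f v :=
    Finset.sum_subset Finset.subset_union_left fun v _ hv => hf.2.1 v hv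
  rw [h1, h2]

theorem closedCell_mono {s t : Finset V} (hst : s ⊆ t) : closedCell s ⊆ closedCell t :=
  fun _ hf => closedCell_of_support hf fun v hv => hf.2.1 v fun h => hv (hst h)

theorem nonempty_of_mem_closedCell {s : Finset V} {f : V → ℝ} (hf : f ∈ closedCell s) :
    s.Nonempty := by
  by_contra h
  rw [Finset.not_nonempty_iff_eq_empty] at h
  have := hf.2.2
  simp [h] at this

theorem le_one_of_mem_closedCell {s : Finset V} {f : V → ℝ} (hf : f ∈ closedCell s) (v : V) :
    f v ≤ 1 := by
  by_cases hv : v ∈ s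
  · exact hf.2.2 ▸ Finset.single_le_sum (fun u _ => hf.1 u) hv
  · rw [hf.2.1 v hv]
    exact zero_le_one

theorem isClosed_closedCell (s : Finset V) : IsClosed (closedCell s) := by
  have : closedCell s = (⋂ v, {f : V → ℝ | 0 ≤ f v}) ∩ (⋂ v, ⋂ (_ : v ∉ s), {f | f v = 0}) ∩
      {f | ∑ v ∈ s, f v = 1} := by
    ext f
    simp [closedCell, and_assoc]
  rw [this]
  refine ((isClosed_iInter fun v => ?_).inter (isClosed_iInter fun v => isClosed_iInter fun _ =>
    ?_)).inter ?_
  · exact isClosed_le continuous_const (continuous_apply v)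
  · exact isClosed_eq (continuous_apply v) continuous_const
  · exact isClosed_eq (by fun_prop) continuous_const

theorem isCompact_closedCell (s : Finset V) : IsCompact (closedCell s) := by
  refine (isCompact_univ_pi fun _ : V => isCompact_Icc (a := (0 : ℝ)) (b := 1)).of_isClosed_subset
    (isClosed_closedCell s) fun f hf v _ => ⟨hf.1 v, le_one_of_mem_closedCell hf v⟩

theorem continuous_iff_cells {Y : Type*} [TopologicalSpace Y] {φ : K.Realization → Y} :
    Continuous φ ↔ ∀ s : {s : Finset V // s ∈ K}, Continuous (φ ∘ K.cellIncl s) := by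
  rw [continuous_iSup_dom]
  exact forall_congr' fun s => continuous_coinduced_dom

theorem continuous_cellIncl (s : {s : Finset V // s ∈ K}) : Continuous (K.cellIncl s) :=
  continuous_iff_cells.1 continuous_id s

/-- Coordinatewise continuity is too weak for the weak topology in general. With supports inside one
finite set, the preimages of finitely many closed cells form a closed cover, and on each of them the
map factors through a cell. -/
theorem continuous_of_coordinates {P : Type*} [TopologicalSpace P] {φ : P → L.Realization}
    (S : Finset U) (hS : ∀ p u, u ∉ S → (φ p).1 u = 0)
    (hc : ∀ u, Continuous fun p => (φ p).1 u) : Continuous φ := by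
  classical
  have hval : Continuous fun p => (φ p).1 := continuous_pi hc
  let A : {t : Finset U // t ∈ S.powerset ∧ t ∈ L} → Set P :=
    fun t => {p | (φ p).1 ∈ closedCell t.1}
  have : Finite {t : Finset U // t ∈ S.powerset ∧ t ∈ L} :=
    Finite.of_injective (fun t => (⟨t.1, t.2.1⟩ : S.powerset)) fun a b h => by
      simpa [Subtype.ext_iff] using h
  refine (locallyFinite_of_finite A).continuous (Set.iUnion_eq_univ_iff.2 fun p => ?_)
    (fun t => (isClosed_closedCell t.1).preimage hval) fun t => ?_
  · obtain ⟨s, hs, hf⟩ := (φ p).2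
    have hf' : (φ p).1 ∈ closedCell (s ∩ S) := closedCell_of_support hf fun u hu => by
      by_cases h : u ∈ s
      · exact hS p u fun h' => hu (Finset.mem_inter.2 ⟨h, h'⟩)
      · exact hf.2.1 u h
    exact ⟨⟨s ∩ S, Finset.mem_powerset.2 Finset.inter_subset_right,
      mem_of_subset hs Finset.inter_subset_left (nonempty_of_mem_closedCell hf')⟩, hf'⟩
  · rw [continuousOn_iff_continuous_domRestrict]
    have : (A t).domRestrict φ = L.cellIncl ⟨t.1, t.2.2⟩ ∘
        fun p : A t => (⟨(φ p.1).1, p.2⟩ : closedCell t.1) := rfl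
    rw [this]
    exact (continuous_cellIncl _).comp
      ((hval.comp continuous_subtype_val).subtype_mk _)

theorem continuous_val : Continuous fun x : K.Realization => x.1 :=
  continuous_iff_cells.2 fun _ => continuous_subtype_val

/-- The product with the interval still has the topology determined by the cells: after currying
into `C(unitInterval, Y)` continuity is tested cell by cell, and uncurrying is allowed because the
interval is locally compact. -/
theorem continuous_prod_unitInterval {Y : Type*} [TopologicalSpace Y]
    {H : K.Realization → unitInterval → Y}
    (hH : ∀ s : {s : Finset V // s ∈ K},
      Continuous fun q : closedCell s.1 × unitInterval => H (K.cellIncl s q.1) q.2) :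
    Continuous fun q : K.Realization × unitInterval => H q.1 q.2 := by
  have hrow (x : K.Realization) : Continuous (H x) := by
    obtain ⟨s, hs, hx⟩ := x.2
    exact (hH ⟨s, hs⟩).comp ((continuous_const (y := (⟨x.1, hx⟩ : closedCell s))).prodMk
      continuous_id)
  let F : C(K.Realization, C(unitInterval, Y)) :=
    ⟨fun x => ⟨H x, hrow x⟩, continuous_iff_cells.2 fun s =>
      (ContinuousMap.curry ⟨_, hH s⟩).continuous⟩
  exact ContinuousMap.continuous_uncurry_of_continuous F

theorem exists_finset_support_of_union {φ ψ : K.Realization → L.Realization} (s : Finset V)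
    (hφ : ∃ S : Finset U, ∀ x, x.1 ∈ closedCell s → ∀ u, u ∉ S → (φ x).1 u = 0)
    (hψ : ∃ S : Finset U, ∀ x, x.1 ∈ closedCell s → ∀ u, u ∉ S → (ψ x).1 u = 0) :
    ∃ S : Finset U, ∀ x, x.1 ∈ closedCell s → ∀ u, u ∉ S → (φ x).1 u = 0 ∧ (ψ x).1 u = 0 := by
  classical
  obtain ⟨S, hS⟩ := hφ
  obtain ⟨T, hT⟩ := hψ
  refine ⟨S ∪ T, fun x hx u hu => ?_⟩
  rw [Finset.mem_union, not_or] at hu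
  exact ⟨hS x hx u hu.1, hT x hx u hu.2⟩

/-- A map is cellwise finite if it sends each closed cell into finitely many closed cells. -/
def CellwiseFinite (φ : K.Realization → L.Realization) : Prop :=
  ∀ s ∈ K, ∃ S : Finset U, ∀ x, x.1 ∈ closedCell s → ∀ u, u ∉ S → (φ x).1 u = 0

theorem CellwiseFinite.id : CellwiseFinite (id : K.Realization → K.Realization) :=
  fun s _ => ⟨s, fun _ hx u hu => hx.2.1 u hu⟩

theorem CellwiseFinite.continuous {φ : K.Realization → L.Realization} (hφ : CellwiseFinite φ)
    (hc : ∀ (s : {s : Finset V // s ∈ K}) (u : U), Continuous fun x => (φ (K.cellIncl s x)).1 u) :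
    Continuous φ := by
  refine continuous_iff_cells.2 fun s => ?_
  obtain ⟨S, hS⟩ := hφ s.1 s.2
  exact continuous_of_coordinates S (fun x u hu => hS _ x.2 u hu) (hc s)

/-- The straight-line homotopy stays in the common face. Finite supports over each cell make it
continuous for the weak topology. -/
theorem homotopic_of_common_face (φ ψ : C(K.Realization, L.Realization))
    (hφ : CellwiseFinite φ) (hψ : CellwiseFinite ψ)
    (h : ∀ x, ∃ t ∈ L, (φ x).1 ∈ closedCell t ∧ (ψ x).1 ∈ closedCell t) :
    φ.Homotopic ψ := by
  have hmem (x : K.Realization) (r : unitInterval) :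
      ∃ t ∈ L, (fun u => (1 - r.1) * (φ x).1 u + r.1 * (ψ x).1 u) ∈ closedCell t := by
    obtain ⟨t, ht, h1, h2⟩ := h x
    refine ⟨t, ht, fun u => ?_, fun u hu => ?_, ?_⟩
    · exact add_nonneg (mul_nonneg (sub_nonneg.2 r.2.2) (h1.1 u)) (mul_nonneg r.2.1 (h2.1 u))
    · change (1 - r.1) * (φ x).1 u + r.1 * (ψ x).1 u = 0
      rw [h1.2.1 u hu, h2.2.1 u hu]
      ring
    · rw [Finset.sum_add_distrib, ← Finset.mul_sum, ← Finset.mul_sum, h1.2.2, h2.2.2]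
      ring
  let H (x : K.Realization) (r : unitInterval) : L.Realization := ⟨_, hmem x r⟩
  have hcell (s : {s : Finset V // s ∈ K}) :
      Continuous fun q : closedCell s.1 × unitInterval => H (K.cellIncl s q.1) q.2 := by
    obtain ⟨S, hS⟩ := exists_finset_support_of_union s.1 (hφ s.1 s.2) (hψ s.1 s.2)
    refine continuous_of_coordinates S (fun q u hu => ?_) fun u => ?_
    · obtain ⟨h1, h2⟩ := hS (K.cellIncl s q.1) q.1.2 u hu
      change (1 - q.2.1) * (φ (K.cellIncl s q.1)).1 u + q.2.1 * (ψ (K.cellIncl s q.1)).1 u = 0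
      rw [h1, h2]
      ring
    · have c1 : Continuous fun q : closedCell s.1 × unitInterval => (φ (K.cellIncl s q.1)).1 u :=
        (continuous_apply u).comp (continuous_val.comp (φ.continuous.comp
          ((continuous_cellIncl s).comp continuous_fst)))
      have c2 : Continuous fun q : closedCell s.1 × unitInterval => (ψ (K.cellIncl s q.1)).1 u :=
        (continuous_apply u).comp (continuous_val.comp (ψ.continuous.comp
          ((continuous_cellIncl s).comp continuous_fst)))
      change Continuous fun q : closedCell s.1 × unitInterval =>
        (1 - q.2.1) * (φ (K.cellIncl s q.1)).1 u + q.2.1 * (ψ (K.cellIncl s q.1)).1 u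
      have c3 : Continuous fun q : closedCell s.1 × unitInterval => q.2.1 :=
        continuous_subtype_val.comp continuous_snd
      exact ((continuous_const.sub c3).mul c1).add (c3.mul c2)
  exact ⟨{
    toFun := fun q => H q.2 q.1
    continuous_toFun := (continuous_prod_unitInterval hcell).comp continuous_swap
    map_zero_left := fun x => Subtype.ext (funext fun u => by simp [H])
    map_one_left := fun x => Subtype.ext (funext fun u => by simp [H]) }⟩

end Cells

end PreAbstractSimplicialComplex

namespace PreAbstractSimplicialComplex

/-! ### Retractions onto subcomplexes -/

section Retraction

variable {U : Type*} {P Q : PreAbstractSimplicialComplex U}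

/-- The inclusion of the realization of a subcomplex. -/
def realizationIncl (h : Q ≤ P) : C(Q.Realization, P.Realization) where
  toFun x := ⟨x.1, x.2.imp fun _ hs => ⟨h hs.1, hs.2⟩⟩
  continuous_toFun := CellwiseFinite.continuous (fun s _ => ⟨s, fun _ hx u hu => hx.2.1 u hu⟩)
    fun _ u => (continuous_apply u).comp continuous_subtype_val

theorem homotopyEquiv_of_retraction (h : Q ≤ P) (r : P.Realization → Q.Realization)
    (hfin : CellwiseFinite r)
    (hc : ∀ (s : {s : Finset U // s ∈ P}) (u : U), Continuous fun x => (r (P.cellIncl s x)).1 u)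
    (hid : ∀ x, r (realizationIncl h x) = x)
    (hface : ∀ x, ∃ t ∈ P, (r x).1 ∈ closedCell t ∧ x.1 ∈ closedCell t) :
    Nonempty (ContinuousMap.HomotopyEquiv P.Realization Q.Realization) := by
  let ρ : C(P.Realization, Q.Realization) := ⟨r, hfin.continuous hc⟩
  refine ⟨⟨ρ, realizationIncl h, ?_, ?_⟩⟩
  · exact homotopic_of_common_face _ _ hfin CellwiseFinite.id hface
  · have : ρ.comp (realizationIncl h) = ContinuousMap.id _ := ContinuousMap.ext hid
    rw [this]

end Retraction

/-! ### Pushing faces into a subcomplex towards a vertex -/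

section Push

variable {U : Type*} (Q : PreAbstractSimplicialComplex U) (p : U)

/-- The levels at which truncating `x` away from `p` leaves a face of `Q` or nothing. -/
def truncationLevels (x : U → ℝ) : Set ℝ :=
  {c | 0 ≤ c ∧ ∃ t : Finset U, (t = ∅ ∨ t ∈ Q) ∧ ∀ u, u ∉ t → u ≠ p → x u ≤ c}

/-- The least level at which truncating `x` away from `p` leaves a face of `Q` or nothing. -/
noncomputable def truncationLevel (x : U → ℝ) : ℝ := sInf (truncationLevels Q p x)

theorem bddBelow_truncationLevels (x : U → ℝ) : BddBelow (truncationLevels Q p x) :=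
  ⟨0, fun _ hc => hc.1⟩

/-- Intersecting the witness with `s` changes nothing, since `x` vanishes off `s`. So finitely many
witnesses suffice, each giving a closed condition. -/
theorem isClosed_truncationLevels {s : Finset U} {x : U → ℝ} (hx : x ∈ closedCell s) :
    IsClosed (truncationLevels Q p x) := by
  classical
  have : truncationLevels Q p x = ⋃ t ∈ {t ∈ s.powerset | t = ∅ ∨ t ∈ Q},
      Set.Ici 0 ∩ {c | ∀ u, u ∉ t → u ≠ p → x u ≤ c} := by
    ext c
    simp only [Set.mem_iUnion, Finset.mem_filter, Finset.mem_powerset, exists_prop]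
    constructor
    · rintro ⟨h0, t, ht, htc⟩
      refine ⟨t ∩ s, ⟨Finset.inter_subset_right, ?_⟩, h0, fun u hu hup => ?_⟩
      · rcases ht with rfl | ht
        · exact Or.inl (Finset.empty_inter s)
        · rcases (t ∩ s).eq_empty_or_nonempty with h | h
          · exact Or.inl h
          · exact Or.inr (mem_of_subset ht Finset.inter_subset_left h)
      · by_cases hus : u ∈ s
        · exact htc u (fun h => hu (Finset.mem_inter.2 ⟨h, hus⟩)) hup
        · exact (hx.2.1 u hus).trans_le h0
    · rintro ⟨t, ⟨-, ht⟩, h0, htc⟩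
      exact ⟨h0, t, ht, htc⟩
  rw [this]
  refine isClosed_biUnion_finset fun t _ => isClosed_Ici.inter ?_
  simp only [Set.ofPred_forall]
  exact isClosed_iInter fun u => isClosed_iInter fun _ => isClosed_iInter fun _ =>
    isClosed_le continuous_const continuous_id

/-- The infimum is attained. The empty witness makes level 1 admissible, as coordinates are at most
1. -/
theorem truncationLevel_mem {s : Finset U} {x : U → ℝ} (hx : x ∈ closedCell s) :
    truncationLevel Q p x ∈ truncationLevels Q p x :=
  (isClosed_truncationLevels Q p hx).csInf_mem
    ⟨1, zero_le_one, ∅, Or.inl rfl, fun u _ _ => le_one_of_mem_closedCell hx u⟩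
    (bddBelow_truncationLevels Q p x)

theorem truncationLevel_eq_zero {s : Finset U} (hs : s ∈ Q) {x : U → ℝ} (hx : x ∈ closedCell s) :
    truncationLevel Q p x = 0 :=
  le_antisymm (csInf_le (bddBelow_truncationLevels Q p x)
    ⟨le_rfl, s, Or.inr hs, fun u hu _ => (hx.2.1 u hu).le⟩) (truncationLevel_mem Q p hx).1

/-- Raising the level by the ℓ¹ distance keeps the same witness valid for `y`. The level is thus
1-Lipschitz on each cell, which gives its continuity. -/
theorem truncationLevel_le_add {s : Finset U} {x y : U → ℝ} (hx : x ∈ closedCell s)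
    (hy : y ∈ closedCell s) :
    truncationLevel Q p y ≤ truncationLevel Q p x + ∑ u ∈ s, |x u - y u| := by
  obtain ⟨h0, t, ht, htc⟩ := truncationLevel_mem Q p hx
  have hsum : 0 ≤ ∑ u ∈ s, |x u - y u| := Finset.sum_nonneg fun _ _ => abs_nonneg _
  refine csInf_le (bddBelow_truncationLevels Q p y)
    ⟨add_nonneg h0 hsum, t, ht, fun u hut hup => ?_⟩
  by_cases hus : u ∈ s
  · have h1 : |x u - y u| ≤ ∑ u ∈ s, |x u - y u| :=
      Finset.single_le_sum (f := fun u => |x u - y u|) (fun _ _ => abs_nonneg _) hus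
    have h2 := neg_abs_le (x u - y u)
    have h3 := htc u hut hup
    linarith
  · rw [hy.2.1 u hus]
    exact add_nonneg h0 hsum

theorem continuous_truncationLevel (s : Finset U) :
    Continuous fun x : closedCell s => truncationLevel Q p x.1 := by
  refine continuous_iff_continuousAt.2 fun x => ?_
  rw [ContinuousAt, tendsto_iff_dist_tendsto_zero]
  have hb : Continuous fun y : closedCell s => ∑ u ∈ s, |x.1 u - y.1 u| :=
    continuous_finsetSum _ fun u _ => (continuous_const.sub
      ((continuous_apply u).comp continuous_subtype_val)).abs
  have hb0 : Filter.Tendsto (fun y : closedCell s => ∑ u ∈ s, |x.1 u - y.1 u|) (𝓝 x) (𝓝 0) := by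
    simpa using hb.tendsto x
  refine squeeze_zero (fun _ => dist_nonneg) (fun y => ?_) hb0
  rw [Real.dist_eq, abs_le]
  have h1 := truncationLevel_le_add Q p x.2 y.2
  have h2 := truncationLevel_le_add Q p y.2 x.2
  simp only [abs_sub_comm (y.1 _)] at h2
  constructor <;> linarith

variable [DecidableEq U]

/-- The coordinates away from `p`, truncated at the truncation level. -/
noncomputable def truncation (x : U → ℝ) (u : U) : ℝ :=
  if u = p then 0 else max (x u - truncationLevel Q p x) 0

/-- Truncate `x` away from `p` and move the mass to `p`. -/
noncomputable def push (x : U → ℝ) (u : U) : ℝ :=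
  if u = p then 1 - ∑ᶠ q, truncation Q p x q else truncation Q p x u

variable {Q p}

theorem truncation_nonneg (x : U → ℝ) (u : U) : 0 ≤ truncation Q p x u := by
  unfold truncation
  split_ifs
  exacts [le_rfl, le_max_right _ _]

theorem truncation_eq_zero_of_notMem {s : Finset U} {x : U → ℝ} (hx : x ∈ closedCell s) {u : U}
    (hu : u ∉ s) : truncation Q p x u = 0 := by
  unfold truncation
  split_ifs
  · rfl
  · rw [hx.2.1 u hu]
    exact max_eq_right (by linarith [(truncationLevel_mem Q p hx).1])

theorem truncation_le {s : Finset U} {x : U → ℝ} (hx : x ∈ closedCell s) (u : U) :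
    truncation Q p x u ≤ x u := by
  unfold truncation
  split_ifs
  · exact hx.1 u
  · exact max_le (by linarith [(truncationLevel_mem Q p hx).1]) (hx.1 u)

theorem finsum_truncation {s : Finset U} {x : U → ℝ} (hx : x ∈ closedCell s) :
    ∑ᶠ q, truncation Q p x q = ∑ q ∈ s, truncation Q p x q :=
  finsum_eq_sum_of_support_subset _ fun u hu => by
    by_contra h
    exact hu (truncation_eq_zero_of_notMem hx h)

theorem push_mem_closedCell_insert {s : Finset U} {x : U → ℝ} (hx : x ∈ closedCell s) :
    push Q p x ∈ closedCell (insert p s) := by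
  refine ⟨fun u => ?_, fun u hu => ?_, ?_⟩
  · unfold push
    split_ifs
    · rw [finsum_truncation hx, sub_nonneg, ← hx.2.2]
      exact Finset.sum_le_sum fun u _ => truncation_le hx u
    · exact truncation_nonneg x u
  · rw [Finset.mem_insert, not_or] at hu
    rw [push, if_neg hu.1, truncation_eq_zero_of_notMem hx hu.2]
  · have h1 : ∀ u ∈ insert p s, push Q p x u =
        (if u = p then 1 - ∑ᶠ q, truncation Q p x q else 0) + truncation Q p x u := fun u _ => by
      by_cases h : u = p <;> simp [push, truncation, h]
    have h2 : ∑ u ∈ insert p s, truncation Q p x u = ∑ u ∈ s, truncation Q p x u :=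
      Finset.sum_insert_of_eq_zero_if_notMem fun h => truncation_eq_zero_of_notMem hx h
    rw [Finset.sum_congr rfl h1, Finset.sum_add_distrib, h2, Finset.sum_ite_eq',
      if_pos (Finset.mem_insert_self p s), finsum_truncation hx]
    ring

theorem push_eq_self {s : Finset U} (hs : s ∈ Q) {x : U → ℝ} (hx : x ∈ closedCell s) :
    push Q p x = x := by
  have h0 := truncationLevel_eq_zero Q p hs hx
  have hne (u : U) (hu : u ≠ p) : truncation Q p x u = x u := by
    rw [truncation, if_neg hu, h0, sub_zero, max_eq_left (hx.1 u)]
  have hne' (u : U) (hu : u ≠ p) : push Q p x u = x u := by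
    rw [push, if_neg hu, hne u hu]
  funext u
  -- The coordinate at `p` is forced by the others, because both points have total mass 1.
  by_cases hu : u = p
  · subst hu
    have h1 := (push_mem_closedCell_insert (Q := Q) (p := u) hx).2.2
    have h2 := (closedCell_mono (Finset.subset_insert u s) hx).2.2
    rw [← Finset.add_sum_erase _ _ (Finset.mem_insert_self u s)] at h1 h2
    rw [Finset.sum_congr rfl fun q hq => hne' q (Finset.ne_of_mem_erase hq)] at h1
    linarith
  · exact hne' u hu

/-- The vertices other than `p` that survive truncation form a face of `Q` or nothing. Joined with
`p` they stay in `P` by `h1`, hence in `Q` by `h2`; if none survives, `hp` applies. -/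
theorem exists_face_push {P : PreAbstractSimplicialComplex U} (hp : {p} ∈ Q)
    (h1 : ∀ s ∈ P, s ∉ Q → insert p s ∈ P) (h2 : ∀ s ∈ Q, insert p s ∈ P → insert p s ∈ Q)
    {s : Finset U} (hs : s ∈ P) {x : U → ℝ} (hx : x ∈ closedCell s) :
    ∃ t ∈ Q, push Q p x ∈ closedCell t := by
  by_cases hsQ : s ∈ Q
  · exact ⟨s, hsQ, by rwa [push_eq_self hsQ hx]⟩
  obtain ⟨h0, t, ht, htc⟩ := truncationLevel_mem Q p hx
  let s' := {u ∈ s | u ≠ p ∧ truncationLevel Q p x < x u}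
  have hs't : s' ⊆ t := fun u hu => by
    by_contra h
    have hu' := (Finset.mem_filter.1 hu).2
    exact absurd (htc u h hu'.1) (not_le.2 hu'.2)
  refine ⟨insert p s', ?_, closedCell_of_support (push_mem_closedCell_insert hx) fun u hu => ?_⟩
  · rcases s'.eq_empty_or_nonempty with h | h
    · rw [h]
      exact hp
    · refine h2 s' ?_ (mem_of_subset (h1 s hs hsQ)
        (Finset.insert_subset_insert p (Finset.filter_subset _ s)) (Finset.insert_nonempty p s'))
      rcases ht with rfl | ht
      · exact absurd (Finset.subset_empty.1 hs't) h.ne_empty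
      · exact mem_of_subset ht hs't h
  · rw [Finset.mem_insert, not_or] at hu
    rw [push, if_neg hu.1]
    by_cases hus : u ∈ s
    · rw [truncation, if_neg hu.1]
      refine max_eq_right (sub_nonpos.2 (not_lt.1 fun h => hu.2 ?_))
      exact Finset.mem_filter.2 ⟨hus, hu.1, h⟩
    · exact truncation_eq_zero_of_notMem hx hus

theorem continuous_truncation (s : Finset U) (u : U) :
    Continuous fun x : closedCell s => truncation Q p x.1 u := by
  unfold truncation
  split_ifs
  · exact continuous_const
  · exact (((continuous_apply u).comp continuous_subtype_val).sub
      (continuous_truncationLevel Q p s)).max continuous_const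

theorem continuous_push (s : Finset U) (u : U) :
    Continuous fun x : closedCell s => push Q p x.1 u := by
  unfold push
  split_ifs
  · simp only [finsum_truncation (Subtype.prop _)]
    exact continuous_const.sub (continuous_finsetSum _ fun q _ => continuous_truncation s q)
  · exact continuous_truncation s u

/-- Faces missing from a subcomplex can be pushed into it towards a vertex `p` to which all of them
can be joined. -/
theorem homotopyEquiv_of_push {P : PreAbstractSimplicialComplex U} (hQP : ∀ s ∈ Q, s ∈ P) (hp : {p} ∈ Q)
    (h1 : ∀ s ∈ P, s ∉ Q → insert p s ∈ P) (h2 : ∀ s ∈ Q, insert p s ∈ P → insert p s ∈ Q) :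
    Nonempty (ContinuousMap.HomotopyEquiv P.Realization Q.Realization) := by
  refine homotopyEquiv_of_retraction hQP
    (fun x => ⟨push Q p x.1, x.2.elim fun s hs => exists_face_push hp h1 h2 hs.1 hs.2⟩)
    (fun s _ => ⟨insert p s, fun x hx u hu => (push_mem_closedCell_insert hx).2.1 u hu⟩)
    (fun s u => continuous_push s.1 u) (fun x => ?_) (fun x => ?_)
  · obtain ⟨s, hs, hx⟩ := x.2
    exact Subtype.ext (push_eq_self hs hx)
  · obtain ⟨s, hs, hx⟩ := x.2
    by_cases hsQ : s ∈ Q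
    · exact ⟨s, hs, by simpa only [push_eq_self hsQ hx] using hx, hx⟩
    · exact ⟨insert p s, h1 s hs hsQ, push_mem_closedCell_insert hx,
        closedCell_mono (Finset.subset_insert p s) hx⟩

end Push

end PreAbstractSimplicialComplex

namespace PreAbstractSimplicialComplex

/-! ### Relabelling vertices -/

section Relabel

variable {U V : Type*} {K : PreAbstractSimplicialComplex V} {L : PreAbstractSimplicialComplex U}

theorem extend_mem_closedCell (ι : V ↪ U) {s : Finset V} {x : V → ℝ} (hx : x ∈ closedCell s) :
    Function.extend ι x 0 ∈ closedCell (s.map ι) := by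
  refine ⟨fun u => ?_, fun u hu => ?_, ?_⟩
  · by_cases h : ∃ v, ι v = u
    · obtain ⟨v, rfl⟩ := h
      rw [ι.injective.extend_apply]
      exact hx.1 v
    · rw [Function.extend_apply' _ _ _ h, Pi.zero_apply]
  · by_cases h : ∃ v, ι v = u
    · obtain ⟨v, rfl⟩ := h
      rw [ι.injective.extend_apply]
      exact hx.2.1 v fun hv => hu (Finset.mem_map_of_mem ι hv)
    · rw [Function.extend_apply' _ _ _ h, Pi.zero_apply]
  · rw [Finset.sum_map, ← hx.2.2]
    exact Finset.sum_congr rfl fun v _ => ι.injective.extend_apply _ _ _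

theorem comp_mem_closedCell (ι : V ↪ U) {s : Finset V} {y : U → ℝ}
    (hy : y ∈ closedCell (s.map ι)) : y ∘ ι ∈ closedCell s := by
  refine ⟨fun v => hy.1 _, fun v hv => hy.2.1 _ fun h => hv ((Finset.mem_map' ι).1 h), ?_⟩
  have := hy.2.2
  rwa [Finset.sum_map] at this

theorem homotopyEquiv_of_relabel (ι : V ↪ U) (hKL : ∀ s ∈ K, s.map ι ∈ L)
    (hLK : ∀ t ∈ L, ∃ s ∈ K, s.map ι = t) :
    Nonempty (ContinuousMap.HomotopyEquiv K.Realization L.Realization) := by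
  let F (x : K.Realization) : L.Realization := ⟨Function.extend ι x.1 0, by
    obtain ⟨s, hs, hx⟩ := x.2
    exact ⟨s.map ι, hKL s hs, extend_mem_closedCell ι hx⟩⟩
  let B (y : L.Realization) : K.Realization := ⟨y.1 ∘ ι, by
    obtain ⟨t, ht, hy⟩ := y.2
    obtain ⟨s, hs, rfl⟩ := hLK t ht
    exact ⟨s, hs, comp_mem_closedCell ι hy⟩⟩
  have hF : Continuous F := by
    refine CellwiseFinite.continuous
      (fun s _ => ⟨s.map ι, fun x hx u hu => (extend_mem_closedCell ι hx).2.1 u hu⟩) fun s u => ?_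
    change Continuous fun x : closedCell s.1 => Function.extend ι x.1 0 u
    by_cases h : ∃ v, ι v = u
    · obtain ⟨v, rfl⟩ := h
      simp only [ι.injective.extend_apply]
      exact (continuous_apply v).comp continuous_subtype_val
    · simp only [Function.extend_apply' _ _ _ h]
      exact continuous_const
  have hB : Continuous B := by
    refine CellwiseFinite.continuous (fun t ht => ?_) fun s v =>
      (continuous_apply (ι v)).comp continuous_subtype_val
    obtain ⟨s, hs, rfl⟩ := hLK t ht
    exact ⟨s, fun y hy v hv => (comp_mem_closedCell ι hy).2.1 v hv⟩
  have hBF (x) : B (F x) = x := Subtype.ext (funext fun v => ι.injective.extend_apply _ _ _)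
  have hFB (y) : F (B y) = y := by
    refine Subtype.ext (funext fun u => ?_)
    change Function.extend ι (y.1 ∘ ι) 0 u = y.1 u
    by_cases h : ∃ v, ι v = u
    · obtain ⟨v, rfl⟩ := h
      rw [ι.injective.extend_apply, Function.comp_apply]
    · rw [Function.extend_apply' _ _ _ h, Pi.zero_apply]
      obtain ⟨t, ht, hy⟩ := y.2
      obtain ⟨s, hs, rfl⟩ := hLK t ht
      refine (hy.2.1 u fun hu => h ?_).symm
      obtain ⟨v, -, rfl⟩ := Finset.mem_map.1 hu
      exact ⟨v, rfl⟩
  exact ⟨(Homeomorph.mk ⟨F, B, hBF, hFB⟩ hF hB).toHomotopyEquiv⟩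

end Relabel

/-! ### Simplicial and topological suspension -/

section Suspension

variable {V : Type*}

/-- The simplicial suspension: the join with two isolated vertices. -/
def susp (K : PreAbstractSimplicialComplex V) : PreAbstractSimplicialComplex (V ⊕ Bool) where
  faces := {s | s.Nonempty ∧ ¬ (Sum.inr false ∈ s ∧ Sum.inr true ∈ s) ∧
    (s.toLeft = ∅ ∨ s.toLeft ∈ K)}
  isRelLowerSet_faces := by
    rintro s ⟨hs, hp, hl⟩
    refine ⟨hs, fun t hts ht => ⟨ht, fun h => hp ⟨hts h.1, hts h.2⟩, ?_⟩⟩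
    have hsub := Finset.toLeft_subset_toLeft hts
    rcases t.toLeft.eq_empty_or_nonempty with h | h
    · exact Or.inl h
    · rcases hl with hl | hl
      · exact Or.inl (Finset.subset_empty.1 (hl ▸ hsub))
      · exact Or.inr (mem_of_subset hl hsub h)

variable {K : PreAbstractSimplicialComplex V}

theorem mem_susp {s : Finset (V ⊕ Bool)} : s ∈ K.susp ↔ s.Nonempty ∧
    ¬ (Sum.inr false ∈ s ∧ Sum.inr true ∈ s) ∧ (s.toLeft = ∅ ∨ s.toLeft ∈ K) := Iff.rfl

/-- The coordinates of the point at height `t` over `x` in the simplicial suspension. -/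
def suspCoord (x : V → ℝ) (t : ℝ) : V ⊕ Bool → ℝ :=
  Sum.elim (fun v => min (2 * t) (2 - 2 * t) * x v)
    fun b => max (if b then 2 * t - 1 else 1 - 2 * t) 0

theorem suspCoord_mem_closedCell {s : Finset V} {x : V → ℝ} (hx : x ∈ closedCell s)
    (t : unitInterval) : ∃ b, suspCoord x t ∈ closedCell (s.disjSum {b}) := by
  have h0 := t.2.1
  have h1 := t.2.2
  have hpos : ∀ u, 0 ≤ suspCoord x t u := by
    rintro (v | b)
    · exact mul_nonneg (le_min (by linarith) (by linarith)) (hx.1 v)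
    · exact le_max_right _ _
  have hsum : ∑ v ∈ s, min (2 * t.1) (2 - 2 * t.1) * x v = min (2 * t.1) (2 - 2 * t.1) := by
    rw [← Finset.mul_sum, hx.2.2, mul_one]
  rcases le_total (2 * t.1) 1 with h | h
  · refine ⟨false, hpos, ?_, ?_⟩
    · rintro (v | _ | _) hu
      · rw [Finset.inl_mem_disjSum] at hu
        simp [suspCoord, hx.2.1 v hu]
      · simp at hu
      · simp [suspCoord, h]
    · rw [Finset.sum_disjSum]
      simp only [suspCoord, Sum.elim_inl, Sum.elim_inr, hsum, Finset.sum_singleton]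
      simp only [Bool.false_eq_true, if_false]
      rw [min_eq_left (by linarith), max_eq_left (by linarith)]
      ring
  · refine ⟨true, hpos, ?_, ?_⟩
    · rintro (v | _ | _) hu
      · rw [Finset.inl_mem_disjSum] at hu
        simp [suspCoord, hx.2.1 v hu]
      · simp [suspCoord, h]
      · simp at hu
    · rw [Finset.sum_disjSum]
      simp only [suspCoord, Sum.elim_inl, Sum.elim_inr, hsum, Finset.sum_singleton]
      simp only [if_true]
      rw [min_eq_right (by linarith), max_eq_left (by linarith)]
      ring

theorem disjSum_singleton_mem_susp {s : Finset V} (hs : s ∈ K) (b : Bool) :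
    s.disjSum {b} ∈ K.susp := by
  refine ⟨⟨Sum.inr b, by simp⟩, ?_, Or.inr (by rwa [Finset.toLeft_disjSum])⟩
  cases b <;> simp

theorem singleton_inr_mem_susp (b : Bool) : {Sum.inr b} ∈ K.susp := by
  refine ⟨Finset.singleton_nonempty _, ?_, Or.inl ?_⟩
  · cases b <;> simp
  · ext v
    simp

/-- The cylinder over a realization maps onto the simplicial suspension. -/
def suspCylinder (x : K.Realization) (t : unitInterval) : K.susp.Realization :=
  ⟨suspCoord x.1 t, by
    obtain ⟨s, hs, hx⟩ := x.2
    obtain ⟨b, hb⟩ := suspCoord_mem_closedCell hx t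
    exact ⟨_, disjSum_singleton_mem_susp hs b, hb⟩⟩

/-- The poles of the simplicial suspension. -/
noncomputable def suspPole (b : Bool) : K.susp.Realization :=
  ⟨Sum.elim 0 fun c => if c = b then 1 else 0, _, singleton_inr_mem_susp b, by
    refine ⟨?_, ?_, ?_⟩
    · rintro (v | c)
      · exact le_rfl
      · simp only [Sum.elim_inr]
        split_ifs
        exacts [zero_le_one, le_rfl]
    · rintro (v | c) hu
      · rfl
      · simpa using hu
    · simp⟩

theorem suspCylinder_zero (x : K.Realization) : suspCylinder x 0 = suspPole false := by
  refine Subtype.ext (funext ?_)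
  rintro (v | _ | _) <;> simp [suspCylinder, suspPole, suspCoord]

theorem suspCylinder_one (x : K.Realization) : suspCylinder x 1 = suspPole true := by
  refine Subtype.ext (funext ?_)
  rintro (v | _ | _) <;> (simp [suspCylinder, suspPole, suspCoord]; try norm_num)

theorem continuous_suspCoord (u : V ⊕ Bool) :
    Continuous fun q : (V → ℝ) × ℝ => suspCoord q.1 q.2 u := by
  rcases u with v | b
  · simp only [suspCoord, Sum.elim_inl]
    fun_prop
  · cases b <;> simp only [suspCoord, Sum.elim_inr, if_true, Bool.false_eq_true, if_false] <;>
    fun_prop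

theorem continuous_suspCylinder :
    Continuous fun q : K.Realization × unitInterval => suspCylinder q.1 q.2 := by
  refine continuous_prod_unitInterval fun s => ?_
  refine continuous_of_coordinates (s.1.disjSum Finset.univ) (fun q u hu => ?_) fun u => ?_
  · obtain ⟨b, hb⟩ := suspCoord_mem_closedCell q.1.2 q.2
    exact hb.2.1 u fun h => hu (Finset.disjSum_mono subset_rfl (Finset.subset_univ _) h)
  · exact (continuous_suspCoord u).comp
      ((continuous_subtype_val.comp continuous_fst).prodMk
        (continuous_subtype_val.comp continuous_snd))

/-- The comparison map from the suspension of the realization to the realization of the simplicial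
suspension. -/
noncomputable def suspComparison (K : PreAbstractSimplicialComplex V) :
    Suspension K.Realization → K.susp.Realization :=
  Quot.lift (Sum.elim (fun q => suspCylinder q.1 q.2) suspPole) (by
    rintro _ _ (x | x)
    · exact suspCylinder_zero x
    · exact suspCylinder_one x)

theorem continuous_suspComparison : Continuous (suspComparison K) :=
  continuous_quot_lift _ (continuous_suspCylinder.sumElim
    continuous_of_discreteTopology)

theorem suspCylinder_eq_pole {x : K.Realization} {t : unitInterval} {b : Bool}
    (h : suspCylinder x t = suspPole b) : (b = false ∧ t = 0) ∨ (b = true ∧ t = 1) := by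
  have hb := congrFun (congrArg Subtype.val h) (Sum.inr b)
  simp only [suspCylinder, suspPole, suspCoord, Sum.elim_inr] at hb
  have h0 := t.2.1
  have h1 := t.2.2
  cases b
  · left
    refine ⟨rfl, Subtype.ext ?_⟩
    change t.1 = 0
    rcases max_cases (1 - 2 * t.1) 0 with hm | hm <;> simp at hb <;> linarith
  · right
    refine ⟨rfl, Subtype.ext ?_⟩
    change t.1 = 1
    rcases max_cases (2 * t.1 - 1) 0 with hm | hm <;> simp at hb <;> linarith

theorem suspPole_injective : Function.Injective (suspPole : Bool → K.susp.Realization) := by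
  intro b c h
  have := congrFun (congrArg Subtype.val h) (Sum.inr b)
  simp only [suspPole, Sum.elim_inr, if_true] at this
  by_contra hne
  rw [if_neg hne] at this
  exact one_ne_zero this

theorem suspCylinder_injective {x y : K.Realization} {t r : unitInterval}
    (h : suspCylinder x t = suspCylinder y r) : t = r ∧ (t ≠ 0 → t ≠ 1 → x = y) := by
  have h' (u) : suspCoord x.1 t u = suspCoord y.1 r u := congrFun (congrArg Subtype.val h) u
  have hf : max (1 - 2 * t.1) 0 = max (1 - 2 * r.1) 0 := h' (Sum.inr false)
  have ht : max (2 * t.1 - 1) 0 = max (2 * r.1 - 1) 0 := h' (Sum.inr true)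
  have htr : t = r := by
    refine Subtype.ext ?_
    rcases max_cases (1 - 2 * t.1) 0 with h1 | h1 <;>
    rcases max_cases (1 - 2 * r.1) 0 with h2 | h2 <;>
    rcases max_cases (2 * t.1 - 1) 0 with h3 | h3 <;>
    rcases max_cases (2 * r.1 - 1) 0 with h4 | h4 <;> linarith
  subst htr
  refine ⟨rfl, fun h0 h1 => Subtype.ext (funext fun v => ?_)⟩
  have hv : min (2 * t.1) (2 - 2 * t.1) * x.1 v = min (2 * t.1) (2 - 2 * t.1) * y.1 v :=
    h' (Sum.inl v)
  have h0' : 0 < t.1 := unitInterval.pos_iff_ne_zero.2 h0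
  have h1' : t.1 < 1 := unitInterval.lt_one_iff_ne_one.2 h1
  exact mul_left_cancel₀ (lt_min (by linarith) (by linarith)).ne' hv

theorem suspComparison_injective : Function.Injective (suspComparison K) := by
  have key (q : K.Realization × unitInterval) (b : Bool)
      (h : suspCylinder q.1 q.2 = suspPole b) :
      Quot.mk (SuspensionRel K.Realization) (Sum.inl q) = Quot.mk _ (Sum.inr b) := by
    obtain ⟨x, t⟩ := q
    rcases suspCylinder_eq_pole h with ⟨rfl, h'⟩ | ⟨rfl, h'⟩
    · obtain rfl : t = 0 := h'
      exact Quot.sound (.south x)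
    · obtain rfl : t = 1 := h'
      exact Quot.sound (.north x)
  rintro ⟨q | b⟩ ⟨q' | b'⟩ h
  · change suspCylinder q.1 q.2 = suspCylinder q'.1 q'.2 at h
    by_cases h0 : q.2 = 0
    · have hq : suspCylinder q.1 q.2 = suspPole false := by rw [h0, suspCylinder_zero]
      exact (key q false hq).trans (key q' false (h.symm.trans hq)).symm
    by_cases h1 : q.2 = 1
    · have hq : suspCylinder q.1 q.2 = suspPole true := by rw [h1, suspCylinder_one]
      exact (key q true hq).trans (key q' true (h.symm.trans hq)).symm
    · obtain ⟨ht, hx⟩ := suspCylinder_injective h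
      rw [Prod.ext (hx h0 h1) ht]
  · exact key q b' h
  · exact (key q' b h.symm).symm
  · rw [suspPole_injective (K := K) h]

/-- The base point is the part of `y` on `V`, rescaled to mass 1, and the height is read off from
the pole coordinates, at most one of which is nonzero. -/
theorem exists_suspCoord_eq {s : Finset (V ⊕ Bool)} (hs : s ∈ K.susp) (hl : s.toLeft ∈ K)
    {y : V ⊕ Bool → ℝ} (hy : y ∈ closedCell s) :
    ∃ x ∈ closedCell s.toLeft, ∃ t : unitInterval, suspCoord x t = y := by
  classical
  set m := ∑ v ∈ s.toLeft, y (Sum.inl v) with hm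
  have hsum : m + (y (Sum.inr true) + y (Sum.inr false)) = 1 := by
    have h := hy.2.2
    rw [← Finset.toLeft_disjSum_toRight (u := s), Finset.sum_disjSum] at h
    rw [← h, ← Fintype.sum_bool fun b => y (Sum.inr b)]
    congr 1
    refine (Finset.sum_subset (Finset.subset_univ _) fun b _ hb => hy.2.1 _ ?_).symm
    rwa [Finset.mem_toRight] at hb
  have hm0 : 0 ≤ m := Finset.sum_nonneg fun v _ => hy.1 _
  have hf := hy.1 (Sum.inr false)
  have ht := hy.1 (Sum.inr true)
  have hout (v : V) (hv : v ∉ s.toLeft) : y (Sum.inl v) = 0 :=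
    hy.2.1 _ fun h => hv (Finset.mem_toLeft.2 h)
  have hx : ∃ x ∈ closedCell s.toLeft, ∀ v, m * x v = y (Sum.inl v) := by
    rcases hm0.eq_or_lt with h0 | h0
    -- At a pole there is nothing to rescale, and any vertex of the face serves as base point.
    · obtain ⟨v₀, hv₀⟩ := nonempty_of_mem hl
      refine ⟨Pi.single v₀ 1, ⟨fun v => ?_, fun v hv => ?_, ?_⟩, fun v => ?_⟩
      · rw [Pi.single_apply]
        split_ifs
        exacts [zero_le_one, le_rfl]
      · refine Pi.single_eq_of_ne ?_ _
        rintro rfl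
        exact hv hv₀
      · simp [Pi.single_apply, hv₀]
      · rw [← h0, zero_mul]
        by_cases hv : v ∈ s.toLeft
        · exact ((Finset.sum_eq_zero_iff_of_nonneg fun v _ => hy.1 (Sum.inl v)).1
            (hm.symm.trans h0.symm) v hv).symm
        · exact (hout v hv).symm
    · refine ⟨fun v => y (Sum.inl v) / m, ⟨fun v => div_nonneg (hy.1 _) hm0, fun v hv => ?_, ?_⟩,
        fun v => mul_div_cancel₀ _ h0.ne'⟩
      · simp only [hout v hv, zero_div]
      · rw [← Finset.sum_div, ← hm, div_self h0.ne']
  obtain ⟨x, hx, hxy⟩ := hx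
  have hpole : y (Sum.inr false) = 0 ∨ y (Sum.inr true) = 0 := by
    by_contra! h
    exact hs.2.1 ⟨by_contra fun h' => h.1 (hy.2.1 _ h'), by_contra fun h' => h.2 (hy.2.1 _ h')⟩
  -- The pole coordinates at height `t` are the positive parts of 1 - 2t and 2t - 1; their
  -- difference determines `t`.
  refine ⟨x, hx, ⟨(1 - y (Sum.inr false) + y (Sum.inr true)) / 2, by linarith, by linarith⟩, ?_⟩
  funext u
  rcases u with v | b
  · simp only [suspCoord, Sum.elim_inl]
    rw [← hxy v]
    congr 1
    rcases hpole with h | h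
    · rw [min_eq_right] <;> linarith
    · rw [min_eq_left] <;> linarith
  · cases b <;> simp only [suspCoord, Sum.elim_inr, if_true, Bool.false_eq_true, if_false] <;>
    rcases hpole with h | h
    · rw [max_eq_right] <;> linarith
    · rw [max_eq_left] <;> linarith
    · rw [max_eq_left] <;> linarith
    · rw [max_eq_right] <;> linarith

theorem subsingleton_closedCell_of_toLeft_eq_empty {s : Finset (V ⊕ Bool)} (hs : s ∈ K.susp)
    (hl : s.toLeft = ∅) : ∃ b, ∀ y ∈ closedCell s, y = (suspPole (K := K) b).1 := by
  obtain ⟨u, hu⟩ := hs.1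
  have hinl (v : V) : Sum.inl v ∉ s := fun h => by
    simpa [hl] using Finset.mem_toLeft.2 h
  obtain ⟨b, rfl⟩ : ∃ b, u = Sum.inr b := by
    rcases u with v | b
    · exact absurd hu (hinl v)
    · exact ⟨b, rfl⟩
  have hsb : s = {Sum.inr b} := by
    refine Finset.eq_singleton_iff_unique_mem.2 ⟨hu, ?_⟩
    rintro (v | c) hc
    · exact absurd hc (hinl v)
    · have := hs.2.1
      cases b <;> cases c <;> simp_all
  refine ⟨b, fun y hy => funext fun u => ?_⟩
  by_cases hub : u = Sum.inr b
  · subst hub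
    have := hy.2.2
    rw [hsb, Finset.sum_singleton] at this
    simp [suspPole, this]
  · rw [hy.2.1 u (by simpa [hsb] using hub)]
    rcases u with v | c
    · rfl
    · simp only [suspPole, Sum.elim_inr]
      rw [if_neg fun h => hub (congrArg _ h)]

theorem suspComparison_surjective : Function.Surjective (suspComparison K) := by
  intro y
  obtain ⟨s, hs, hy⟩ := y.2
  rcases hs.2.2 with hl | hl
  · obtain ⟨b, hb⟩ := subsingleton_closedCell_of_toLeft_eq_empty hs hl
    exact ⟨Quot.mk _ (Sum.inr b), Subtype.ext (hb _ hy).symm⟩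
  · obtain ⟨x, hx, t, h⟩ := exists_suspCoord_eq hs hl hy
    exact ⟨Quot.mk _ (Sum.inl (⟨x, _, hl, hx⟩, t)), Subtype.ext h⟩

/-- The suspension of the realization is the realization of the simplicial suspension. -/
noncomputable def suspHomeomorph (K : PreAbstractSimplicialComplex V) :
    Suspension K.Realization ≃ₜ K.susp.Realization where
  toEquiv := Equiv.ofBijective (suspComparison K) ⟨suspComparison_injective,
    suspComparison_surjective⟩
  continuous_toFun := continuous_suspComparison
  continuous_invFun := by
    set e := Equiv.ofBijective (suspComparison K) ⟨suspComparison_injective,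
      suspComparison_surjective⟩
    change Continuous e.symm
    refine continuous_iff_cells.2 fun s => ?_
    rcases s.2.2.2 with hl | hl
    · obtain ⟨b, hb⟩ := subsingleton_closedCell_of_toLeft_eq_empty s.2 hl
      have : Subsingleton (closedCell s.1) :=
        ⟨fun x y => Subtype.ext ((hb _ x.2).trans (hb _ y.2).symm)⟩
      exact continuous_of_discreteTopology
    -- The part `A` of the compact cylinder lying over the cell maps onto it. A continuous
    -- surjection from a compact to a Hausdorff space is a quotient map, so the inverse need only be
    -- continuous on `A`, where it is the class map.
    · let A : Set (closedCell s.1.toLeft × unitInterval) :=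
        {q | suspCoord q.1.1 q.2 ∈ closedCell s.1}
      have hcoord : Continuous fun q : closedCell s.1.toLeft × unitInterval =>
          suspCoord q.1.1 q.2.1 :=
        continuous_pi fun u => (continuous_suspCoord u).comp
          ((continuous_subtype_val.comp continuous_fst).prodMk
            (continuous_subtype_val.comp continuous_snd))
      have : CompactSpace (closedCell s.1.toLeft) :=
        isCompact_iff_compactSpace.1 (isCompact_closedCell _)
      have : CompactSpace A :=
        isCompact_iff_compactSpace.1 ((isClosed_closedCell s.1).preimage hcoord).isCompact
      let g : A → closedCell s.1 := fun q => ⟨suspCoord q.1.1.1 q.1.2, q.2⟩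
      have hg : Continuous g := (hcoord.comp continuous_subtype_val).subtype_mk _
      have hsurj : Function.Surjective g := by
        rintro ⟨y, hy⟩
        obtain ⟨x, hx, t, rfl⟩ := exists_suspCoord_eq s.2 hl hy
        exact ⟨⟨(⟨x, hx⟩, t), hy⟩, rfl⟩
      refine (IsQuotientMap.of_surjective_continuous hsurj hg).continuous_iff.2 ?_
      have : (e.symm ∘ K.susp.cellIncl s) ∘ g = fun q : A =>
          (Quot.mk _ (Sum.inl (K.cellIncl ⟨_, hl⟩ q.1.1, q.1.2)) : Suspension K.Realization) := by
        funext q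
        exact e.symm_apply_eq.2 (Subtype.ext rfl)
      rw [this]
      exact continuous_quot_mk.comp (continuous_inl.comp
        (((continuous_cellIncl ⟨_, hl⟩).comp (continuous_fst.comp continuous_subtype_val)).prodMk
          (continuous_snd.comp continuous_subtype_val)))

end Suspension

end PreAbstractSimplicialComplex

/-! ### Functoriality of the suspension -/

namespace Suspension

variable {X Y : Type*}

/-- Suspension of maps. -/
def map (f : X → Y) : Suspension X → Suspension Y :=
  Quot.map (Sum.map (Prod.map f id) id) (by
    rintro _ _ (x | x)
    · exact .south (f x)
    · exact .north (f x))

theorem continuous_map [TopologicalSpace X] [TopologicalSpace Y] {f : X → Y} (hf : Continuous f) :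
    Continuous (map f) :=
  continuous_quot_lift _ (continuous_quot_mk.comp
    (Continuous.sumMap (hf.prodMap continuous_id) continuous_id))

theorem map_map_of_leftInverse {f : X → Y} {g : Y → X} (h : Function.LeftInverse g f) :
    Function.LeftInverse (map g) (map f) := by
  rintro ⟨⟨x, t⟩ | b⟩
  · change Quot.mk _ (Sum.inl (g (f x), t)) = _
    rw [h x]
  · rfl

/-- Homeomorphic spaces have homeomorphic suspensions. -/
def mapHomeomorph [TopologicalSpace X] [TopologicalSpace Y] (e : X ≃ₜ Y) :
    Suspension X ≃ₜ Suspension Y where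
  toFun := map e
  invFun := map e.symm
  left_inv := map_map_of_leftInverse e.left_inv
  right_inv := map_map_of_leftInverse e.right_inv
  continuous_toFun := continuous_map e.continuous
  continuous_invFun := continuous_map e.symm.continuous

end Suspension

namespace SimpleGraph

open PreAbstractSimplicialComplex

/-! ### The subdivided edge: from Θ(G̃) to the double suspension -/

section Subdivision

variable {V : Type*} (G : SimpleGraph V) (v w : V)

theorem mem_theta {G : SimpleGraph V} {s : Finset V} :
    s ∈ G.theta ↔ s.Nonempty ∧ ∃ a b, G.Adj a b ∧ a ∉ s ∧ b ∉ s := by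
  refine and_congr_right fun _ => ⟨?_, ?_⟩
  · rintro ⟨_, ⟨a, b, hab, rfl⟩, h⟩
    exact ⟨a, b, hab, fun ha => (h ha).2 (by simp), fun hb => (h hb).2 (by simp)⟩
  · rintro ⟨a, b, hab, ha, hb⟩
    refine ⟨_, ⟨a, b, hab, rfl⟩, fun u hu => ⟨trivial, ?_⟩⟩
    rintro (rfl | rfl)
    exacts [ha hu, hb hu]

/-- The vertices of a double suspension over `V`. -/
abbrev DoubleSuspVertex (V : Type*) := (V ⊕ Bool) ⊕ Bool

/-- The old vertices together with the inner poles `x₁, x₃` and the outer pole `x₂`. -/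
def insertThreeEmbedding (V : Type*) : V ⊕ Fin 3 ↪ DoubleSuspVertex V where
  toFun := Sum.elim (fun a => .inl (.inl a))
    ![.inl (.inr false), .inr false, .inl (.inr true)]
  inj' := by
    rintro (a | i) (b | j) h
    · simpa using h
    · fin_cases j <;> simp at h
    · fin_cases i <;> simp at h
    · fin_cases i <;> fin_cases j <;> simp at h ⊢

/-- Some edge of `G` other than `vw` is disjoint from `s`. -/
def AvoidsOldEdge (s : Finset (DoubleSuspVertex V)) : Prop :=
  ∃ a b, G.Adj a b ∧ s(a, b) ≠ s(v, w) ∧ .inl (.inl a) ∉ s ∧ .inl (.inl b) ∉ s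

variable {G v w}

theorem AvoidsOldEdge.mono {s t : Finset (DoubleSuspVertex V)} (h : G.AvoidsOldEdge v w s)
    (hts : t ⊆ s) : G.AvoidsOldEdge v w t :=
  let ⟨a, b, hab, hne, ha, hb⟩ := h
  ⟨a, b, hab, hne, fun h => ha (hts h), fun h => hb (hts h)⟩

theorem avoidsOldEdge_insert_inr [DecidableEq (DoubleSuspVertex V)]
    {s : Finset (DoubleSuspVertex V)} {b : Bool} :
    G.AvoidsOldEdge v w (insert (.inr b) s) ↔ G.AvoidsOldEdge v w s := by
  simp [AvoidsOldEdge]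

theorem avoidsOldEdge_insert_inl_inr [DecidableEq (DoubleSuspVertex V)]
    {s : Finset (DoubleSuspVertex V)} {b : Bool} :
    G.AvoidsOldEdge v w (insert (.inl (.inr b)) s) ↔ G.AvoidsOldEdge v w s := by
  simp [AvoidsOldEdge]

/-- The complex of the nonempty finite sets with a given hereditary property. -/
def complexOf {U : Type*} (p : Finset U → Prop) (hp : ∀ s t, t ⊆ s → p s → p t) :
    PreAbstractSimplicialComplex U where
  faces := {s | s.Nonempty ∧ p s}
  isRelLowerSet_faces := fun _ hs => ⟨hs.1, fun _ hts ht => ⟨ht, hp _ _ hts hs.2⟩⟩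

theorem mem_complexOf {U : Type*} {p : Finset U → Prop} {hp : ∀ s t, t ⊆ s → p s → p t}
    {s : Finset U} : s ∈ complexOf p hp ↔ s.Nonempty ∧ p s := Iff.rfl

variable (G v w)

/-- Some edge of the subdivided graph is disjoint from `s`. -/
def AvoidsEdge (s : Finset (DoubleSuspVertex V)) : Prop :=
  G.AvoidsOldEdge v w s ∨ (.inl (.inl v) ∉ s ∧ .inl (.inr false) ∉ s) ∨
    (.inl (.inr false) ∉ s ∧ .inr false ∉ s) ∨ (.inr false ∉ s ∧ .inl (.inr true) ∉ s) ∨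
    (.inl (.inr true) ∉ s ∧ .inl (.inl w) ∉ s)

/-- Some edge of the subdivided graph without endpoint `x₂` is disjoint from `s`. -/
def AvoidsOuterEdge (s : Finset (DoubleSuspVertex V)) : Prop :=
  G.AvoidsOldEdge v w s ∨ (.inl (.inl v) ∉ s ∧ .inl (.inr false) ∉ s) ∨
    (.inl (.inr true) ∉ s ∧ .inl (.inl w) ∉ s)

/-- The theta complex of the subdivided graph, on the vertices of the double suspension. -/
def thetaInsertThree : PreAbstractSimplicialComplex (DoubleSuspVertex V) :=
  complexOf (fun s => .inr true ∉ s ∧ G.AvoidsEdge v w s) fun s t hts h => by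
    have := fun h => AvoidsOldEdge.mono (G := G) (v := v) (w := w) (s := s) h hts
    unfold AvoidsEdge at *
    grind

/-- The theta complex of the subdivided graph, with the faces that contain neither `x₂` nor both
`x₁` and `x₃` coned off. -/
def thetaConed : PreAbstractSimplicialComplex (DoubleSuspVertex V) :=
  complexOf (fun s => (.inr true ∉ s ∧ G.AvoidsEdge v w s) ∨
    (.inr false ∉ s ∧ ¬ (.inl (.inr false) ∈ s ∧ .inl (.inr true) ∈ s))) fun s t hts h => by
    have := fun h => AvoidsOldEdge.mono (G := G) (v := v) (w := w) (s := s) h hts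
    unfold AvoidsEdge at *
    grind

/-- The part of `thetaConed` without faces containing both `x₁` and `x₃`. -/
def thetaConedSplit : PreAbstractSimplicialComplex (DoubleSuspVertex V) :=
  complexOf (fun s => ¬ (.inl (.inr false) ∈ s ∧ .inl (.inr true) ∈ s) ∧
    ((.inr true ∉ s ∧ G.AvoidsEdge v w s) ∨ .inr false ∉ s)) fun s t hts h => by
    have := fun h => AvoidsOldEdge.mono (G := G) (v := v) (w := w) (s := s) h hts
    unfold AvoidsEdge at *
    grind

/-- The suspension of the link of `x₂` in the part of the theta complex without faces containing
both `x₁` and `x₃`. -/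
def thetaLinkSusp : PreAbstractSimplicialComplex (DoubleSuspVertex V) :=
  complexOf (fun s => ¬ (.inl (.inr false) ∈ s ∧ .inl (.inr true) ∈ s) ∧
    ¬ (.inr false ∈ s ∧ .inr true ∈ s) ∧ G.AvoidsOuterEdge v w s) fun s t hts h => by
    have := fun h => AvoidsOldEdge.mono (G := G) (v := v) (w := w) (s := s) h hts
    unfold AvoidsOuterEdge at *
    grind

/-- The faces of `thetaLinkSusp` that avoid `v` or an old edge. -/
def thetaLinkSuspLeft : PreAbstractSimplicialComplex (DoubleSuspVertex V) :=
  complexOf (fun s => ¬ (.inl (.inr false) ∈ s ∧ .inl (.inr true) ∈ s) ∧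
    ¬ (.inr false ∈ s ∧ .inr true ∈ s) ∧ G.AvoidsOuterEdge v w s ∧
    (G.AvoidsOldEdge v w s ∨ .inl (.inl v) ∉ s)) fun s t hts h => by
    have := fun h => AvoidsOldEdge.mono (G := G) (v := v) (w := w) (s := s) h hts
    unfold AvoidsOuterEdge at *
    grind

variable {G v w}

/-- The faces to be removed contain the new apex y and otherwise lie in B. Adding `v` keeps this
form; any old vertex would serve. -/
theorem homotopyEquiv_thetaConed_thetaInsertThree :
    Nonempty (ContinuousMap.HomotopyEquiv (G.thetaConed v w).Realization
      (G.thetaInsertThree v w).Realization) := by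
  classical
  refine homotopyEquiv_of_push (p := .inl (.inl v)) ?_ ?_ ?_ ?_ <;>
  simp only [thetaConed, thetaInsertThree, mem_complexOf, AvoidsEdge, Finset.insert_nonempty,
    Finset.singleton_nonempty, true_and]
  · grind
  · simp
  · grind
  · grind

/-- A face with both x₁ and x₃ can only miss an old edge, so x₂ may be added to it. -/
theorem homotopyEquiv_thetaConed_thetaConedSplit :
    Nonempty (ContinuousMap.HomotopyEquiv (G.thetaConed v w).Realization
      (G.thetaConedSplit v w).Realization) := by
  classical
  refine homotopyEquiv_of_push (p := .inr false) ?_ ?_ ?_ ?_ <;>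
  simp only [thetaConed, thetaConedSplit, mem_complexOf, AvoidsEdge, Finset.insert_nonempty,
    Finset.singleton_nonempty, true_and, avoidsOldEdge_insert_inr]
  · grind
  · simp
  · grind
  · grind

/-- A face with x₂ already misses an edge not ending in x₂, so every face to be removed is without
x₂ and can be joined to y. -/
theorem homotopyEquiv_thetaConedSplit_thetaLinkSusp :
    Nonempty (ContinuousMap.HomotopyEquiv (G.thetaConedSplit v w).Realization
      (G.thetaLinkSusp v w).Realization) := by
  classical
  refine homotopyEquiv_of_push (p := .inr true) ?_ ?_ ?_ ?_ <;>
  simp only [thetaLinkSusp, thetaConedSplit, mem_complexOf, AvoidsEdge, AvoidsOuterEdge,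
    Finset.insert_nonempty, Finset.singleton_nonempty, true_and, avoidsOldEdge_insert_inr]
  · grind
  · simp
  · grind
  · grind

/-- A face to be removed contains `v` and misses no old edge, so it misses x₃w. As x₃ is absent, x₁
can be added. -/
theorem homotopyEquiv_thetaLinkSusp_thetaLinkSuspLeft :
    Nonempty (ContinuousMap.HomotopyEquiv (G.thetaLinkSusp v w).Realization
      (G.thetaLinkSuspLeft v w).Realization) := by
  classical
  refine homotopyEquiv_of_push (p := .inl (.inr false)) ?_ ?_ ?_ ?_ <;>
  simp only [thetaLinkSusp, thetaLinkSuspLeft, mem_complexOf, AvoidsOuterEdge,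
    Finset.insert_nonempty, Finset.singleton_nonempty, true_and, avoidsOldEdge_insert_inl_inr]
  · grind
  · simp
  · grind
  · grind

/-- Here the adjacency of `v` and `w` enters: missing both must count as missing an edge of `G`. -/
theorem exists_adj_notMem_iff (hvw : G.Adj v w) {s : Finset (DoubleSuspVertex V)} :
    (∃ a b, G.Adj a b ∧ .inl (.inl a) ∉ s ∧ .inl (.inl b) ∉ s) ↔
      G.AvoidsOldEdge v w s ∨ (.inl (.inl v) ∉ s ∧ .inl (.inl w) ∉ s) := by
  constructor
  · rintro ⟨a, b, hab, ha, hb⟩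
    by_cases h : s(a, b) = s(v, w)
    · rcases Sym2.eq_iff.1 h with ⟨rfl, rfl⟩ | ⟨rfl, rfl⟩
      exacts [Or.inr ⟨ha, hb⟩, Or.inr ⟨hb, ha⟩]
    · exact Or.inl ⟨a, b, hab, h, ha, hb⟩
  · rintro (⟨a, b, hab, -, h⟩ | h)
    exacts [⟨a, b, hab, h⟩, ⟨v, w, hvw, h⟩]

theorem mem_susp_susp_theta (hvw : G.Adj v w) {s : Finset (DoubleSuspVertex V)} :
    s ∈ G.theta.susp.susp ↔ s.Nonempty ∧ ¬ (.inl (.inr false) ∈ s ∧ .inl (.inr true) ∈ s) ∧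
      ¬ (.inr false ∈ s ∧ .inr true ∈ s) ∧
      (G.AvoidsOldEdge v w s ∨ (.inl (.inl v) ∉ s ∧ .inl (.inl w) ∉ s)) := by
  rw [mem_susp, mem_susp, mem_theta]
  simp only [Finset.mem_toLeft, exists_adj_notMem_iff hvw]
  -- The empty cases in `mem_susp` are absorbed by the last alternative, since a set without old
  -- vertices misses both `v` and `w`.
  have h1 : s.toLeft = ∅ → Sum.inl (Sum.inr false) ∉ s ∧ s.toLeft.toLeft = ∅ := fun h => by
    refine ⟨fun h' => ?_, ?_⟩
    · simpa [h] using Finset.mem_toLeft.2 h'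
    · ext
      simp [h]
  have h2 : s.toLeft.toLeft = ∅ → Sum.inl (Sum.inl v) ∉ s ∧ Sum.inl (Sum.inl w) ∉ s := fun h => by
    constructor <;> intro h' <;>
    simpa [h] using Finset.mem_toLeft.2 (Finset.mem_toLeft.2 h')
  have h3 := s.toLeft.eq_empty_or_nonempty
  have h4 := s.toLeft.toLeft.eq_empty_or_nonempty
  tauto

/-- A face to be removed misses `v` and no old edge, but contains `w`, so it must miss vx₁. As x₁ is
absent, x₃ can be added. -/
theorem homotopyEquiv_thetaLinkSuspLeft_susp_susp (hvw : G.Adj v w) :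
    Nonempty (ContinuousMap.HomotopyEquiv (G.thetaLinkSuspLeft v w).Realization
      G.theta.susp.susp.Realization) := by
  classical
  refine homotopyEquiv_of_push (p := .inl (.inr true)) ?_ ?_ ?_ ?_ <;>
  simp only [mem_susp_susp_theta hvw, thetaLinkSuspLeft, mem_complexOf, AvoidsOuterEdge,
    Finset.insert_nonempty, Finset.singleton_nonempty, true_and, avoidsOldEdge_insert_inl_inr]
  · grind
  · simp
  · grind
  · grind

theorem insertThree_adj {x y : V ⊕ Fin 3} : (G.insertThree v w).Adj x y ↔
    (∃ a b, G.Adj a b ∧ s(a, b) ≠ s(v, w) ∧ x = .inl a ∧ y = .inl b) ∨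
      s(x, y) = s(.inl v, .inr 0) ∨ s(x, y) = s(.inr 0, .inr 1) ∨ s(x, y) = s(.inr 1, .inr 2) ∨
      s(x, y) = s(.inr 2, .inl w) := by
  rw [insertThree, fromEdgeSet_adj]
  simp only [Set.mem_union, Set.mem_insert_iff, Set.mem_singleton_iff]
  constructor
  · rintro ⟨⟨e, ⟨he, hne⟩, hxy⟩ | h, -⟩
    · induction e with | _ a b
      rw [Sym2.map_mk, Sym2.eq_iff] at hxy
      rcases hxy with ⟨rfl, rfl⟩ | ⟨rfl, rfl⟩
      · exact Or.inl ⟨a, b, he, hne, rfl, rfl⟩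
      · exact Or.inl ⟨b, a, he.symm, by rwa [Sym2.eq_swap], rfl, rfl⟩
    · exact Or.inr h
  · rintro (⟨a, b, hab, hne, rfl, rfl⟩ | h)
    · exact ⟨Or.inl ⟨s(a, b), ⟨hab, hne⟩, rfl⟩, fun h => hab.ne (Sum.inl_injective h)⟩
    · refine ⟨Or.inr h, ?_⟩
      rintro rfl
      simp only [Sym2.eq_iff] at h
      grind

theorem map_mem_thetaInsertThree {s : Finset (V ⊕ Fin 3)} :
    s.map (insertThreeEmbedding V) ∈ G.thetaInsertThree v w ↔ s ∈ (G.insertThree v w).theta := by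
  have ho (a : V) : .inl (.inl a) ∈ s.map (insertThreeEmbedding V) ↔ .inl a ∈ s :=
    Finset.mem_map' (insertThreeEmbedding V) (a := Sum.inl a)
  have h0 : .inl (.inr false) ∈ s.map (insertThreeEmbedding V) ↔ .inr 0 ∈ s :=
    Finset.mem_map' (insertThreeEmbedding V) (a := Sum.inr 0)
  have h1 : .inr false ∈ s.map (insertThreeEmbedding V) ↔ .inr 1 ∈ s :=
    Finset.mem_map' (insertThreeEmbedding V) (a := Sum.inr 1)
  have h2 : .inl (.inr true) ∈ s.map (insertThreeEmbedding V) ↔ .inr 2 ∈ s :=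
    Finset.mem_map' (insertThreeEmbedding V) (a := Sum.inr 2)
  have h3 : .inr true ∉ s.map (insertThreeEmbedding V) := by
    rw [Finset.mem_map]
    rintro ⟨a | i, -, h⟩
    · exact Sum.inl_ne_inr h
    · fin_cases i
      · exact Sum.inl_ne_inr h
      · exact Bool.false_ne_true (Sum.inr_injective h)
      · exact Sum.inl_ne_inr h
  rw [mem_theta, thetaInsertThree, mem_complexOf, Finset.map_nonempty, AvoidsEdge, AvoidsOldEdge]
  simp only [ho, h0, h1, h2, h3, not_false_eq_true, true_and]
  refine and_congr_right fun _ => ⟨?_, ?_⟩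
  · rintro (⟨a, b, hab, hne, h⟩ | h | h | h | h)
    · exact ⟨_, _, insertThree_adj.2 (Or.inl ⟨a, b, hab, hne, rfl, rfl⟩), h⟩
    · exact ⟨_, _, insertThree_adj.2 (by simp), h⟩
    · exact ⟨_, _, insertThree_adj.2 (by simp), h⟩
    · exact ⟨_, _, insertThree_adj.2 (by simp), h⟩
    · exact ⟨_, _, insertThree_adj.2 (by simp), h⟩
  · rintro ⟨x, y, hxy, hx, hy⟩
    rcases insertThree_adj.1 hxy with ⟨a, b, hab, hne, rfl, rfl⟩ | h | h | h | h
    · exact Or.inl ⟨a, b, hab, hne, hx, hy⟩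
    all_goals
      rcases Sym2.eq_iff.1 h with ⟨rfl, rfl⟩ | ⟨rfl, rfl⟩ <;> tauto

theorem homotopyEquiv_insertThree_theta :
    Nonempty (ContinuousMap.HomotopyEquiv (G.insertThree v w).theta.Realization
      (G.thetaInsertThree v w).Realization) := by
  refine homotopyEquiv_of_relabel (insertThreeEmbedding V)
    (fun s hs => map_mem_thetaInsertThree.2 hs) fun t ht => ?_
  have hrange : (t : Set (DoubleSuspVertex V)) ⊆ Set.range (insertThreeEmbedding V) := by
    rintro ((a | _ | _) | _ | _) hu
    · exact ⟨.inl a, rfl⟩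
    · exact ⟨.inr 0, rfl⟩
    · exact ⟨.inr 2, rfl⟩
    · exact ⟨.inr 1, rfl⟩
    · exact absurd hu ht.2.1
  obtain ⟨s, rfl⟩ : ∃ s : Finset (V ⊕ Fin 3), s.map (insertThreeEmbedding V) = t := by
    classical
    obtain ⟨s, -, hs⟩ := Finset.subset_set_image_iff.1 (hrange.trans Set.image_univ.ge)
    exact ⟨s, by rw [Finset.map_eq_image, hs]⟩
  exact ⟨s, map_mem_thetaInsertThree.1 ht, rfl⟩

end Subdivision

end SimpleGraph

theorem mainTheorem8 {V : Type*} (G : SimpleGraph V) (v w : V) (hvw : G.Adj v w) :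
    Nonempty (ContinuousMap.HomotopyEquiv
      (G.insertThree v w).theta.Realization
      (Suspension (Suspension G.theta.Realization))) := by
  obtain ⟨e₁⟩ := SimpleGraph.homotopyEquiv_insertThree_theta (G := G) (v := v) (w := w)
  obtain ⟨e₂⟩ := SimpleGraph.homotopyEquiv_thetaConed_thetaInsertThree (G := G) (v := v) (w := w)
  obtain ⟨e₃⟩ := SimpleGraph.homotopyEquiv_thetaConed_thetaConedSplit (G := G) (v := v) (w := w)
  obtain ⟨e₄⟩ := SimpleGraph.homotopyEquiv_thetaConedSplit_thetaLinkSusp (G := G) (v := v) (w := w)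
  obtain ⟨e₅⟩ := SimpleGraph.homotopyEquiv_thetaLinkSusp_thetaLinkSuspLeft
    (G := G) (v := v) (w := w)
  obtain ⟨e₆⟩ := SimpleGraph.homotopyEquiv_thetaLinkSuspLeft_susp_susp hvw
  let e₇ := (Suspension.mapHomeomorph G.theta.suspHomeomorph).trans G.theta.susp.suspHomeomorph
  exact ⟨e₁.trans (e₂.symm.trans (e₃.trans (e₄.trans (e₅.trans
    (e₆.trans e₇.toHomotopyEquiv.symm)))))⟩
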